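/- Let $p_1\ge p_2\ge\cdots$ be real numbers with $p_n>1$ for all $n$ and $\sum_{n\ge1}(1-1/p_n)<\infty$. For $x=(x_n)_{n\ge1}\in\ell_1$ put $\vartheta_0(x)=0$, $\vartheta_n(x)=\bigl(\vartheta_{n-1}(x)^{p_n}+|x_n|^{p_n}\bigr)^{1/p_n}$ for $n\ge1$, and $\|x\|_X=\lim_{n\to\infty}\vartheta_n(x)$. Let $X=(\ell_1,\|\cdot\|_X)$, let $(e_n)_{n\ge1}$ be the canonical basis, and put $g_0=e_1+e_2+e_3$, $g_k=e_k+e_{k+1}$ for $k\ge1$, and $\mathcal D=\{\pm g_n/\|g_n\|_X: n\ge0\}$. Then: 1. $2^{-\sum_{n\ge1}(1-1/p_n)}\,\|x\|_1\le\|x\|_X\le\|x\|_1$ for all $x\in\ell_1$, and $X$ is a Banach space. 2. $X$ is smooth, i.e. for every $x\ne0$ there is exactly one bounded linear functional $F$ on $X$ with $\|F\|=1$ and $F(x)=\|x\|_X$. But $X$ is not uniformly smooth: its modulus of smoothness $\rho(u)=\sup_{\|x\|_X=\|y\|_X=1}\frac{\|x+uy\|_X+\|x-uy\|_X}{2}-1$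 is not $o(u)$ as $u\to0$. 3. $\mathcal D$ is a dictionary: it is symmetric, its elements have norm $1$, and its linear span is dense in $X$. The element $f=e_1=g_0-g_2$ lies in the linear span of $\mathcal D$. 4. If moreover $2^{p_3}\le1+2^{p_3/p_2}$ (for instance if $p_2\le\log_2 3$), then for every weakness sequence $(t_n)_{n\ge1}$, $0\le t_n\le1$, the Weak Chebyshev Greedy Algorithm (WCGA) of $f=e_1$ with respect to $\mathcal D$ diverges. That is, there are bounded linear functionals $F_n$ ($n\ge0$), elements $\phi_n\in\mathcal D$ ($n\ge1$) and approximations $G_n$ ($n\ge0$) with $G_0=0$ such that, writing $f_n=f-G_n$, for all $n\ge1$ - $\|F_{n-1}\|\le1$ and $F_{n-1}(f_{n-1})\ge\|f_{n-1}\|_X$, - $F_{n-1}(\phi_n)\ge t_n\sup_{g\in\mathcal D}F_{n-1}(g)$, - $G_n\in\Phi_n=\operatorname{span}\{\phi_1,\dots,\phi_n\}$ and $\|f-G_n\|_X\le\inf_{G\in\Phi_n}\|f-G\|_X$, and $G_n\not\to f$ as $n\to\infty$. Sequences $(p_n)$ satisfying all of these conditions exist; hence smoothness of a Banach space alone does not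 suffice for the convergence of the WCGA. -/

import Mathlib

open Filter Topology Asymptotics

noncomputable section

/-! ### Smoothness, uniform smoothness, dictionaries and the WCGA in a real normed space -/

section General

variable {X : Type*} [NormedAddCommGroup X] [NormedSpace ℝ X]

/-- `F` is a norming functional of `x`. -/
def IsNormingFunctional (F : X →L[ℝ] ℝ) (x : X) : Prop :=
  ‖F‖ = 1 ∧ F x = ‖x‖

variable (X) in
/-- The space is smooth: every non-zero element has exactly one norming functional. -/
def IsSmoothSpace : Prop :=
  ∀ x : X, x ≠ 0 → ∃! F : X →L[ℝ] ℝ, IsNormingFunctional F x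

variable (X) in
/-- The modulus of smoothness
`ρ(u) = sup_{‖x‖ = ‖y‖ = 1} (‖x + u y‖ + ‖x - u y‖) / 2 - 1`. -/
def modulusOfSmoothness (u : ℝ) : ℝ :=
  ⨆ z : Metric.sphere (0 : X) 1 × Metric.sphere (0 : X) 1,
    ((‖(z.1 : X) + u • (z.2 : X)‖ + ‖(z.1 : X) - u • (z.2 : X)‖) / 2 - 1)

variable (X) in
/-- The space is uniformly smooth: `ρ(u) = o(u)` as `u → 0`. -/
def IsUniformlySmoothSpace : Prop :=
  modulusOfSmoothness X =o[𝓝 (0 : ℝ)] fun u : ℝ => u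

/-- A (symmetric) dictionary: normalized elements, closed under negation, with dense span. -/
structure IsDictionary (D : Set X) : Prop where
  norm_eq_one : ∀ g ∈ D, ‖g‖ = 1
  neg_mem : ∀ g ∈ D, -g ∈ D
  dense_span : closure (Submodule.span ℝ D : Set X) = Set.univ

/-- A weakness sequence; `t n` is the parameter used at the `(n+1)`-st step. -/
def IsWeaknessSequence (t : ℕ → ℝ) : Prop :=
  ∀ n, 0 ≤ t n ∧ t n ≤ 1

/-- A realization of the Weak Chebyshev Greedy Algorithm for `f` with respect to `D` and the
weakness sequence `t`.  Here `G n` is the `n`-th approximation (with `G 0 = 0`), `f - G n` is the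
`n`-th remainder, `F n` is the functional chosen for the `n`-th remainder, and `φ n` is the
dictionary element selected at the `(n+1)`-st step, so that `G (n + 1)` is a best approximation
of `f` from the span of `φ 0, …, φ n`. -/
structure IsWCGARealization (D : Set X) (t : ℕ → ℝ) (f : X)
    (F : ℕ → (X →L[ℝ] ℝ)) (φ G : ℕ → X) : Prop where
  G_zero : G 0 = 0
  norm_F_le : ∀ n, ‖F n‖ ≤ 1
  F_remainder : ∀ n, ‖f - G n‖ ≤ F n (f - G n)
  φ_mem : ∀ n, φ n ∈ D
  greedy : ∀ n, t n * (⨆ g : D, F n (g : X)) ≤ F n (φ n)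
  G_mem : ∀ n, G (n + 1) ∈ Submodule.span ℝ (φ '' Set.Iic n)
  chebyshev : ∀ n, ‖f - G (n + 1)‖ ≤ ⨅ H : Submodule.span ℝ (φ '' Set.Iic n), ‖f - (H : X)‖

/-- The WCGA of `f` diverges: some realization produces approximations that do not converge
to `f`. -/
def WCGADiverges (D : Set X) (t : ℕ → ℝ) (f : X) : Prop :=
  ∃ (F : ℕ → (X →L[ℝ] ℝ)) (φ G : ℕ → X),
    IsWCGARealization D t f F φ G ∧ ¬ Tendsto G atTop (𝓝 f)

end General

/-! ### The renorming of `ℓ₁`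

Coordinates and exponents are indexed from `0`: `x n` and `p n` are the `(n+1)`-st coordinate and
the `(n+1)`-st exponent. -/

/-- A non-increasing sequence of exponents `p n > 1` with `∑ (1 - 1 / p n) < ∞`. -/
structure ExponentSeq where
  exponent : ℕ → ℝ
  antitone' : Antitone exponent
  one_lt' : ∀ n, 1 < exponent n
  summable' : Summable fun n => 1 - 1 / exponent n

instance : CoeFun ExponentSeq fun _ => ℕ → ℝ := ⟨ExponentSeq.exponent⟩

/-- `ϑ_0 = 0` and `ϑ_{n+1}(x) = (ϑ_n(x)^p + |x_{n+1}|^p)^{1/p}` with `p = p_{n+1}`. -/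
def vartheta (p x : ℕ → ℝ) : ℕ → ℝ
  | 0 => 0
  | n + 1 => (vartheta p x n ^ p n + |x n| ^ p n) ^ (1 / p n)

lemma vartheta_nonneg (p x : ℕ → ℝ) (n : ℕ) : 0 ≤ vartheta p x n := by
  induction n with
  | zero => exact le_rfl
  | succ n ih => simp only [vartheta]; positivity

lemma vartheta_le_succ (p : ExponentSeq) (x : ℕ → ℝ) (n : ℕ) :
    vartheta p x n ≤ vartheta p x (n + 1) := by
  have hp : 0 < p n := one_pos.trans (p.one_lt' n)
  have h0 := vartheta_nonneg p x n
  calc vartheta p x n = (vartheta p x n ^ p n) ^ (1 / p n) := by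
        rw [one_div, Real.rpow_rpow_inv h0 hp.ne']
    _ ≤ vartheta p x (n + 1) := by
        simp only [vartheta]
        apply Real.rpow_le_rpow (by positivity) _ (by positivity)
        have : 0 ≤ |x n| ^ p n := by positivity
        linarith

lemma vartheta_monotone (p : ExponentSeq) (x : ℕ → ℝ) : Monotone (vartheta p x) :=
  monotone_nat_of_le_succ (vartheta_le_succ p x)

lemma abs_le_vartheta_succ (p : ExponentSeq) (x : ℕ → ℝ) (n : ℕ) :
    |x n| ≤ vartheta p x (n + 1) := by
  have hp : 0 < p n := one_pos.trans (p.one_lt' n)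
  have h0 := vartheta_nonneg p x n
  calc |x n| = (|x n| ^ p n) ^ (1 / p n) := by
        rw [one_div, Real.rpow_rpow_inv (abs_nonneg _) hp.ne']
    _ ≤ vartheta p x (n + 1) := by
        simp only [vartheta]
        apply Real.rpow_le_rpow (by positivity) _ (by positivity)
        have : 0 ≤ vartheta p x n ^ p n := by positivity
        linarith

lemma vartheta_le_sum (p : ExponentSeq) (x : ℕ → ℝ) (n : ℕ) :
    vartheta p x n ≤ ∑ k ∈ Finset.range n, |x k| := by
  induction n with
  | zero => simp [vartheta]
  | succ n ih =>
    rw [Finset.sum_range_succ]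
    have h := Real.rpow_add_rpow_le_add (vartheta_nonneg p x n) (abs_nonneg (x n))
      (p.one_lt' n).le
    simp only [vartheta]
    linarith

lemma vartheta_smul (p : ExponentSeq) (c : ℝ) (x : ℕ → ℝ) (n : ℕ) :
    vartheta p (fun k => c * x k) n = |c| * vartheta p x n := by
  induction n with
  | zero => simp [vartheta]
  | succ n ih =>
    have hp : 0 < p n := one_pos.trans (p.one_lt' n)
    have h0 := vartheta_nonneg p x n
    simp only [vartheta]
    rw [ih, abs_mul, Real.mul_rpow (abs_nonneg _) h0, Real.mul_rpow (abs_nonneg _) (abs_nonneg _),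
      ← mul_add, Real.mul_rpow (by positivity) (by positivity), one_div,
      Real.rpow_rpow_inv (abs_nonneg _) hp.ne']

lemma vartheta_add_le (p : ExponentSeq) (x y : ℕ → ℝ) (n : ℕ) :
    vartheta p (fun k => x k + y k) n ≤ vartheta p x n + vartheta p y n := by
  induction n with
  | zero => simp [vartheta]
  | succ n ih =>
    have hp : 0 < p n := one_pos.trans (p.one_lt' n)
    have hx := vartheta_nonneg p x n
    have hy := vartheta_nonneg p y n
    have hxy := vartheta_nonneg p (fun k => x k + y k) n
    have h := Real.Lp_add_le_of_nonneg (s := (Finset.univ : Finset (Fin 2)))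
      (f := ![vartheta p x n, |x n|]) (g := ![vartheta p y n, |y n|]) (p.one_lt' n).le
      (by intro i _; fin_cases i <;> simp [hx]) (by intro i _; fin_cases i <;> simp [hy])
    simp only [Fin.sum_univ_two, Matrix.cons_val_zero, Matrix.cons_val_one] at h
    refine le_trans ?_ h
    simp only [vartheta]
    gcongr
    exact abs_add_le _ _

/-- The space `X = (ℓ₁, ‖·‖_X)`: a copy of `ℓ₁` as a vector space, with its own norm. -/
def RenormedL1 (_p : ExponentSeq) : Type := lp (fun _ : ℕ => ℝ) 1

namespace RenormedL1

variable {p : ExponentSeq}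

instance : AddCommGroup (RenormedL1 p) := inferInstanceAs (AddCommGroup (lp (fun _ : ℕ => ℝ) 1))

instance : Module ℝ (RenormedL1 p) := inferInstanceAs (Module ℝ (lp (fun _ : ℕ => ℝ) 1))

/-- The identity map from the renormed space to `ℓ₁`. -/
def toL1 : RenormedL1 p ≃ₗ[ℝ] lp (fun _ : ℕ => ℝ) 1 := LinearEquiv.refl ℝ _

/-- The coordinates of an element. -/
def coord (x : RenormedL1 p) (n : ℕ) : ℝ := (toL1 x : ℕ → ℝ) n

/-- `‖x‖_X = lim_n ϑ_n(x)`. -/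
instance : Norm (RenormedL1 p) := ⟨fun x => limUnder atTop (vartheta p (coord x))⟩

lemma summable_coord (x : RenormedL1 p) : Summable fun n => |coord x n| := by
  have h := lp.memℓp (toL1 x)
  rw [memℓp_gen_iff (by simp)] at h
  simpa [coord] using h

lemma bddAbove_vartheta (x : RenormedL1 p) : BddAbove (Set.range (vartheta p (coord x))) := by
  refine ⟨∑' n, |coord x n|, ?_⟩
  rintro _ ⟨n, rfl⟩
  exact (vartheta_le_sum p _ n).trans
    ((summable_coord x).sum_le_tsum _ fun _ _ => abs_nonneg _)

/-- The limit that defines the norm exists. -/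
lemma tendsto_vartheta (x : RenormedL1 p) :
    Tendsto (vartheta p (coord x)) atTop (𝓝 ‖x‖) :=
  tendsto_nhds_limUnder ⟨_, tendsto_atTop_ciSup (vartheta_monotone p _) (bddAbove_vartheta x)⟩

lemma normCore : NormedSpace.Core ℝ (RenormedL1 p) where
  norm_nonneg x := ge_of_tendsto' (tendsto_vartheta x) (vartheta_nonneg p _)
  norm_smul c x := by
    refine tendsto_nhds_unique (tendsto_vartheta (c • x)) ?_
    have h := (tendsto_vartheta x).const_mul |c|
    refine h.congr fun n => ?_
    rw [← vartheta_smul]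
    rfl
  norm_triangle x y := le_of_tendsto_of_tendsto' (tendsto_vartheta (x + y))
    ((tendsto_vartheta x).add (tendsto_vartheta y)) fun n =>
      vartheta_add_le p (coord x) (coord y) n
  norm_eq_zero_iff x := by
    constructor
    · intro h
      apply (toL1 (p := p)).injective
      rw [map_zero]
      ext n
      have h1 : |coord x n| ≤ ‖x‖ := (abs_le_vartheta_succ p (coord x) n).trans
        ((vartheta_monotone p _).ge_of_tendsto (tendsto_vartheta x) (n + 1))
      rw [h] at h1
      exact abs_nonpos_iff.mp h1
    · rintro rfl
      refine tendsto_nhds_unique (tendsto_vartheta (0 : RenormedL1 p)) ?_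
      refine tendsto_const_nhds.congr fun n => ?_
      have h := vartheta_smul p 0 (coord (0 : RenormedL1 p)) n
      rw [abs_zero, zero_mul] at h
      rw [← h]
      congr 1
      funext k
      rw [zero_mul]
      rfl

instance : NormedAddCommGroup (RenormedL1 p) := NormedAddCommGroup.ofCore normCore

instance : NormedSpace ℝ (RenormedL1 p) := NormedSpace.ofCore normCore

variable (p)

/-- The canonical basis; `e p n` is the `(n+1)`-st basis vector. -/
def e (n : ℕ) : RenormedL1 p := toL1.symm (lp.single 1 n 1)

/-- `g_0 = e_1 + e_2 + e_3` and `g_k = e_k + e_{k+1}` for `k ≥ 1` (basis numbered from `1`). -/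
def g : ℕ → RenormedL1 p
  | 0 => e p 0 + e p 1 + e p 2
  | k + 1 => e p k + e p (k + 1)

/-- The dictionary `{± g_n / ‖g_n‖_X : n ≥ 0}`. -/
def dict : Set (RenormedL1 p) :=
  {v | ∃ n : ℕ, v = ‖g p n‖⁻¹ • g p n ∨ v = -(‖g p n‖⁻¹ • g p n)}

end RenormedL1

end

noncomputable section

lemma ExponentSeq.pos (p : ExponentSeq) (n : ℕ) : 0 < p n := one_pos.trans (p.one_lt' n)

lemma ExponentSeq.one_sub_inv_nonneg (p : ExponentSeq) (n : ℕ) : 0 ≤ 1 - 1 / p n := by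
  rw [sub_nonneg, div_le_one (p.pos n)]
  exact (p.one_lt' n).le

lemma ExponentSeq.tendsto_inv (p : ExponentSeq) : Tendsto (fun n => 1 / p n) atTop (𝓝 1) := by
  have h := p.summable'.tendsto_atTop_zero.const_sub 1
  simpa using h

lemma vartheta_succ (p x : ℕ → ℝ) (n : ℕ) :
    vartheta p x (n + 1) = (vartheta p x n ^ p n + |x n| ^ p n) ^ (1 / p n) := rfl

lemma vartheta_mono (p : ExponentSeq) {x y : ℕ → ℝ} {n : ℕ} (h : ∀ k < n, |x k| ≤ |y k|) :
    vartheta p x n ≤ vartheta p y n := by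
  induction n with
  | zero => exact le_rfl
  | succ n ih =>
    have hp := p.pos n
    have hx := vartheta_nonneg p x n
    have h1 := ih fun k hk => h k (by omega)
    have h2 := h n (by omega)
    simp only [vartheta_succ]
    gcongr

lemma vartheta_congr (p : ExponentSeq) {x y : ℕ → ℝ} {n : ℕ} (h : ∀ k < n, |x k| = |y k|) :
    vartheta p x n = vartheta p y n :=
  le_antisymm (vartheta_mono p fun k hk => (h k hk).le) (vartheta_mono p fun k hk => (h k hk).ge)

/-- Beyond the index `n`, `ϑ` depends only on `ϑ_n` and on the remaining coordinates. -/
lemma vartheta_congr_of_le (p : ExponentSeq) {x y : ℕ → ℝ} {n m : ℕ} (hnm : n ≤ m)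
    (h : vartheta p x n = vartheta p y n) (h' : ∀ k, n ≤ k → |x k| = |y k|) :
    vartheta p x m = vartheta p y m := by
  induction m, hnm using Nat.le_induction with
  | base => exact h
  | succ m hm ih => rw [vartheta_succ, vartheta_succ, ih, h' m hm]

lemma vartheta_succ_of_eq_zero (p : ExponentSeq) {x : ℕ → ℝ} {n : ℕ} (h : x n = 0) :
    vartheta p x (n + 1) = vartheta p x n := by
  have hp := p.pos n
  rw [vartheta_succ, h, abs_zero, Real.zero_rpow hp.ne', add_zero, one_div,
    Real.rpow_rpow_inv (vartheta_nonneg p x n) hp.ne']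

lemma vartheta_eq_of_le (p : ExponentSeq) {x : ℕ → ℝ} {n m : ℕ} (hnm : n ≤ m)
    (h : ∀ k, n ≤ k → x k = 0) : vartheta p x m = vartheta p x n := by
  induction m, hnm using Nat.le_induction with
  | base => rfl
  | succ m hm ih => rw [vartheta_succ_of_eq_zero p (h m hm), ih]

lemma vartheta_eq_zero (p : ExponentSeq) {x : ℕ → ℝ} {n : ℕ} (h : ∀ k < n, x k = 0) :
    vartheta p x n = 0 := by
  induction n with
  | zero => rfl
  | succ n ih => rw [vartheta_succ_of_eq_zero p (h n (by omega)), ih fun k hk => h k (by omega)]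

lemma vartheta_succ_of_vartheta_eq_zero (p : ExponentSeq) {x : ℕ → ℝ} {n : ℕ}
    (h : vartheta p x n = 0) : vartheta p x (n + 1) = |x n| := by
  have hp := p.pos n
  rw [vartheta_succ, h, Real.zero_rpow hp.ne', zero_add, one_div,
    Real.rpow_rpow_inv (abs_nonneg _) hp.ne']

lemma two_rpow_mul_add_le {a b q : ℝ} (ha : 0 ≤ a) (hb : 0 ≤ b) (hq : 1 ≤ q) :
    (2 : ℝ) ^ (-(1 - 1 / q)) * (a + b) ≤ (a ^ q + b ^ q) ^ (1 / q) := by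
  have hq0 : 0 < q := by linarith
  have h : (a + b) ^ q ≤ 2 ^ (q - 1) * (a ^ q + b ^ q) := by
    lift a to NNReal using ha
    lift b to NNReal using hb
    exact_mod_cast NNReal.rpow_add_le_mul_rpow_add_rpow a b hq
  have h2 : ((2 : ℝ) ^ (-(1 - 1 / q))) ^ q = 2 ^ (-(q - 1)) := by
    rw [← Real.rpow_mul zero_le_two]
    congr 1
    field_simp
  rw [one_div, Real.le_rpow_inv_iff_of_pos (by positivity) (by positivity) hq0, ← one_div,
    Real.mul_rpow (by positivity) (by positivity), h2]
  calc (2 : ℝ) ^ (-(q - 1)) * (a + b) ^ q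
      ≤ 2 ^ (-(q - 1)) * (2 ^ (q - 1) * (a ^ q + b ^ q)) := by gcongr
    _ = a ^ q + b ^ q := by
      rw [← mul_assoc, ← Real.rpow_add two_pos, neg_add_cancel, Real.rpow_zero, one_mul]

lemma two_rpow_mul_sum_le_vartheta (p : ExponentSeq) (x : ℕ → ℝ) (n : ℕ) :
    (2 : ℝ) ^ (-∑ k ∈ Finset.range n, (1 - 1 / p k)) * ∑ k ∈ Finset.range n, |x k| ≤
      vartheta p x n := by
  induction n with
  | zero => simp [vartheta]
  | succ n ih =>
    have hs : 0 ≤ ∑ k ∈ Finset.range n, (1 - 1 / p k) :=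
      Finset.sum_nonneg fun k _ => p.one_sub_inv_nonneg k
    refine le_trans ?_ (two_rpow_mul_add_le (vartheta_nonneg p x n) (abs_nonneg (x n))
      (p.one_lt' n).le)
    rw [Finset.sum_range_succ, Finset.sum_range_succ, neg_add, Real.rpow_add two_pos,
      mul_comm ((2 : ℝ) ^ _), mul_assoc]
    gcongr
    rw [mul_add]
    gcongr
    exact mul_le_of_le_one_left (abs_nonneg _)
      (Real.rpow_le_one_of_one_le_of_nonpos one_le_two (by linarith))

/-- `ϑ_n` is differentiable along lines at every point where it does not vanish. -/
lemma exists_hasDerivAt_vartheta (p : ExponentSeq) (x y : ℕ → ℝ) (n : ℕ)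
    (h : vartheta p x n ≠ 0) :
    ∃ d, HasDerivAt (fun s : ℝ => vartheta p (fun k => x k + s * y k) n) d 0 := by
  induction n with
  | zero => exact absurd rfl h
  | succ n ih =>
    have hp := p.pos n
    have h1 : ∃ d, HasDerivAt (fun s : ℝ => vartheta p (fun k => x k + s * y k) n ^ p n) d 0 := by
      by_cases h0 : vartheta p x n = 0
      · refine ⟨0, ?_⟩
        have hb : ∀ s : ℝ, vartheta p (fun k => x k + s * y k) n ≤ |s| * vartheta p y n := by
          intro s
          have := vartheta_add_le p x (fun k => s * y k) n
          rwa [vartheta_smul, h0, zero_add] at this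
        rw [hasDerivAt_iff_isLittleO_nhds_zero]
        have hO : (fun s : ℝ => vartheta p (fun k => x k + s * y k) n ^ p n) =O[𝓝 0]
            fun s : ℝ => |s| ^ p n := by
          refine IsBigO.of_bound (vartheta p y n ^ p n) (Eventually.of_forall fun s => ?_)
          have h3 := vartheta_nonneg p (fun k => x k + s * y k) n
          rw [Real.norm_of_nonneg (by positivity), Real.norm_of_nonneg (by positivity), mul_comm,
            ← Real.mul_rpow (abs_nonneg _) (vartheta_nonneg _ _ _)]
          exact Real.rpow_le_rpow h3 (hb s) hp.le
        have ho : (fun s : ℝ => |s| ^ p n) =o[𝓝 0] fun s : ℝ => s := by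
          have := hasDerivAt_abs_rpow 0 (p.one_lt' n)
          rw [hasDerivAt_iff_isLittleO_nhds_zero] at this
          simpa [Real.zero_rpow hp.ne'] using this
        simpa [h0, Real.zero_rpow hp.ne'] using hO.trans_isLittleO ho
      · obtain ⟨d, hd⟩ := ih h0
        exact ⟨_, hd.rpow_const (Or.inl (by simpa using h0))⟩
    obtain ⟨d1, hd1⟩ := h1
    have h2 : HasDerivAt (fun s : ℝ => x n + s * y n) (y n) 0 := by
      simpa using ((hasDerivAt_id (0 : ℝ)).mul_const (y n)).const_add (x n)
    have h3 := (hasDerivAt_abs_rpow (x n + 0 * y n) (p.one_lt' n)).comp (0 : ℝ) h2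
    refine ⟨_, (hd1.add h3).rpow_const (p := 1 / p n) (Or.inl ?_)⟩
    intro hz
    apply h
    simp only [vartheta_succ]
    simp only [Pi.add_apply, Function.comp, zero_mul, add_zero] at hz
    rw [hz, Real.zero_rpow (by positivity)]

/-- A best approximation from a finite-dimensional subspace, together with a functional that
certifies it. -/
lemma exists_best_approx_and_functional {X : Type*} [NormedAddCommGroup X] [NormedSpace ℝ X]
    (V : Submodule ℝ X) [FiniteDimensional ℝ V] (f : X) :
    ∃ G ∈ V, (∀ H ∈ V, ‖f - G‖ ≤ ‖f - H‖) ∧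
      ∃ F : X →L[ℝ] ℝ, ‖F‖ ≤ 1 ∧ (∀ v ∈ V, F v = 0) ∧ F f = ‖f - G‖ := by
  have hlim : Tendsto (fun v : V => ‖f - v‖) (cocompact V) atTop := by
    refine tendsto_atTop_mono (fun v => ?_)
      (tendsto_atTop_add_const_right _ (-‖f‖) (tendsto_norm_cocompact_atTop (E := V)))
    have h := norm_sub_norm_le (v : X) f
    rw [norm_sub_rev] at h
    simpa [sub_eq_add_neg] using h
  obtain ⟨G, hG⟩ := Continuous.exists_forall_le (f := fun v : V => ‖f - v‖) (by fun_prop) hlim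
  refine ⟨G, G.2, fun H hH => hG ⟨H, hH⟩, ?_⟩
  have : IsClosed (V : Set X) := V.closed_of_finiteDimensional
  obtain ⟨L, hL1, hL2⟩ := exists_dual_vector'' ℝ (V.mkQ f)
  have hnorm : ‖V.mkQ f‖ = ‖f - G‖ := by
    have h : ‖V.mkQ f‖ = Metric.infDist f (V : Set X) :=
      QuotientAddGroup.norm_mk (S := V.toAddSubgroup) f
    rw [h]
    refine le_antisymm ?_ ?_
    · rw [← dist_eq_norm]
      exact Metric.infDist_le_dist_of_mem G.2
    · rw [Metric.le_infDist ⟨0, V.zero_mem⟩]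
      intro v hv
      rw [dist_eq_norm]
      exact hG ⟨v, hv⟩
  refine ⟨(L.toLinearMap.comp V.mkQ).mkContinuous 1 fun x => ?_, ?_, ?_, ?_⟩
  · rw [one_mul]
    calc ‖L (V.mkQ x)‖ ≤ ‖L‖ * ‖V.mkQ x‖ := L.le_opNorm _
      _ ≤ 1 * ‖x‖ := by
        gcongr
        exact QuotientAddGroup.norm_mk_le_norm (S := V.toAddSubgroup)
      _ = ‖x‖ := one_mul _
  · exact LinearMap.mkContinuous_norm_le _ zero_le_one _
  · intro v hv
    change L (V.mkQ v) = 0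
    rw [V.mkQ_apply, (Submodule.Quotient.mk_eq_zero V).mpr hv, map_zero]
  · change L (V.mkQ f) = _
    rw [hL2, hnorm]
    rfl

namespace RenormedL1

variable {p : ExponentSeq}

lemma coord_zero (k : ℕ) : coord (0 : RenormedL1 p) k = 0 := rfl

lemma coord_add (x y : RenormedL1 p) (k : ℕ) : coord (x + y) k = coord x k + coord y k := rfl

lemma coord_sub (x y : RenormedL1 p) (k : ℕ) : coord (x - y) k = coord x k - coord y k := rfl

lemma coord_smul (c : ℝ) (x : RenormedL1 p) (k : ℕ) : coord (c • x) k = c * coord x k := rfl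

lemma coord_e (n k : ℕ) : coord (e p n) k = if k = n then 1 else 0 := by
  change (lp.single 1 n (1 : ℝ) : ℕ → ℝ) k = _
  rw [lp.single_apply, Pi.single_apply]

@[ext]
lemma ext_coord {x y : RenormedL1 p} (h : ∀ k, coord x k = coord y k) : x = y := by
  apply (toL1 (p := p)).injective
  ext k
  exact h k

lemma norm_toL1 (x : RenormedL1 p) : ‖toL1 x‖ = ∑' n, |coord x n| := by
  rw [lp.norm_eq_tsum_rpow (by simp)]
  simp [coord]

lemma norm_congr_of_le {x y : RenormedL1 p} {n : ℕ}
    (h : vartheta p (coord x) n = vartheta p (coord y) n)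
    (h' : ∀ k, n ≤ k → |coord x k| = |coord y k|) : ‖x‖ = ‖y‖ := by
  refine tendsto_nhds_unique (tendsto_vartheta x) ((tendsto_vartheta y).congr' ?_)
  filter_upwards [eventually_ge_atTop n] with m hm
  exact (vartheta_congr_of_le p hm h h').symm

lemma vartheta_le_norm (x : RenormedL1 p) (n : ℕ) : vartheta p (coord x) n ≤ ‖x‖ :=
  (vartheta_monotone p _).ge_of_tendsto (tendsto_vartheta x) n

lemma norm_eq_vartheta {x : RenormedL1 p} {n : ℕ} (h : ∀ k, n ≤ k → coord x k = 0) :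
    ‖x‖ = vartheta p (coord x) n := by
  refine tendsto_nhds_unique (tendsto_vartheta x) (tendsto_const_nhds.congr' ?_)
  filter_upwards [eventually_ge_atTop n] with m hm
  exact (vartheta_eq_of_le p hm h).symm

lemma norm_le_norm_toL1 (x : RenormedL1 p) : ‖x‖ ≤ ‖toL1 x‖ := by
  rw [norm_toL1]
  exact le_of_tendsto' (tendsto_vartheta x) fun n => (vartheta_le_sum p _ n).trans
    ((summable_coord x).sum_le_tsum _ fun _ _ => abs_nonneg _)

lemma two_rpow_mul_norm_toL1_le (x : RenormedL1 p) :
    (2 : ℝ) ^ (-∑' n, (1 - 1 / p n)) * ‖toL1 x‖ ≤ ‖x‖ := by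
  rw [norm_toL1]
  refine le_of_tendsto_of_tendsto' ((summable_coord x).hasSum.tendsto_sum_nat.const_mul _)
    (tendsto_vartheta x) fun n => le_trans ?_ (two_rpow_mul_sum_le_vartheta p (coord x) n)
  gcongr
  · exact one_le_two
  · exact p.summable'.sum_le_tsum _ fun k _ => p.one_sub_inv_nonneg k

lemma norm_toL1_le (x : RenormedL1 p) :
    ‖toL1 x‖ ≤ (2 : ℝ) ^ (∑' n, (1 - 1 / p n)) * ‖x‖ := by
  have h := mul_le_mul_of_nonneg_left (two_rpow_mul_norm_toL1_le x)
    (Real.rpow_nonneg zero_le_two (∑' n, (1 - 1 / p n)))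
  rwa [← mul_assoc, ← Real.rpow_add two_pos, add_neg_cancel, Real.rpow_zero, one_mul] at h

instance : CompleteSpace (RenormedL1 p) := by
  let E : RenormedL1 p ≃L[ℝ] lp (fun _ : ℕ => ℝ) 1 :=
    (toL1 (p := p)).toContinuousLinearEquivOfBounds _ 1 norm_toL1_le fun x => by
      simpa using norm_le_norm_toL1 (toL1.symm x)
  exact (completeSpace_congr (e := E.toEquiv) E.isUniformEmbedding).mpr inferInstance

/-- The truncation of an element to its first `n` coordinates. -/
def trunc (n : ℕ) : RenormedL1 p →ₗ[ℝ] RenormedL1 p where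
  toFun x := ∑ k ∈ Finset.range n, coord x k • e p k
  map_add' x y := by simp only [coord_add, add_smul, Finset.sum_add_distrib]
  map_smul' c x := by simp only [coord_smul, mul_smul, Finset.smul_sum, RingHom.id_apply]

/-- The coordinates as linear functionals. -/
def coordₗ (k : ℕ) : RenormedL1 p →ₗ[ℝ] ℝ where
  toFun x := coord x k
  map_add' x y := coord_add x y k
  map_smul' c x := coord_smul c x k

lemma coord_trunc (n : ℕ) (x : RenormedL1 p) (k : ℕ) :
    coord (trunc n x) k = if k < n then coord x k else 0 := by
  change coordₗ k (∑ j ∈ Finset.range n, coord x j • e p j) = _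
  rw [map_sum]
  change ∑ j ∈ Finset.range n, coord (coord x j • e p j) k = _
  simp only [coord_smul, coord_e]
  simp

lemma norm_trunc (n : ℕ) (x : RenormedL1 p) : ‖trunc n x‖ = vartheta p (coord x) n := by
  rw [norm_eq_vartheta (n := n) fun k hk => by rw [coord_trunc, if_neg (by omega)]]
  exact vartheta_congr p fun k hk => by rw [coord_trunc, if_pos hk]

lemma norm_trunc_le (n : ℕ) (x : RenormedL1 p) : ‖trunc n x‖ ≤ ‖x‖ :=
  (norm_trunc n x).trans_le (vartheta_le_norm x n)

lemma trunc_eq_self {n : ℕ} {x : RenormedL1 p} (h : ∀ k, n ≤ k → coord x k = 0) :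
    trunc n x = x := by
  ext k
  rw [coord_trunc]
  split_ifs with hk
  · rfl
  · exact (h k (by omega)).symm

/-- The truncation as a continuous linear map. -/
def truncL (n : ℕ) : RenormedL1 p →L[ℝ] RenormedL1 p :=
  (trunc n).mkContinuous 1 fun x => by simpa using norm_trunc_le n x

lemma truncL_apply (n : ℕ) (x : RenormedL1 p) : truncL n x = trunc n x := rfl

lemma norm_truncL_le (n : ℕ) : ‖truncL (p := p) n‖ ≤ 1 :=
  LinearMap.mkContinuous_norm_le _ zero_le_one _

lemma tendsto_trunc (x : RenormedL1 p) : Tendsto (fun n => trunc n x) atTop (𝓝 x) := by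
  rw [tendsto_iff_norm_sub_tendsto_zero]
  have h0 : Tendsto (fun n => ∑' k, |coord x k| - ∑ k ∈ Finset.range n, |coord x k|) atTop
      (𝓝 0) := by
    simpa using (summable_coord x).hasSum.tendsto_sum_nat.const_sub (∑' k, |coord x k|)
  refine squeeze_zero (fun n => norm_nonneg _) (fun n => ?_) h0
  have h1 := norm_le_norm_toL1 (trunc n x - x)
  rw [norm_toL1] at h1
  refine h1.trans (le_of_eq ?_)
  rw [eq_sub_iff_add_eq, ← (summable_coord x).sum_add_tsum_nat_add n,
    ← (summable_coord (trunc n x - x)).sum_add_tsum_nat_add n, Finset.sum_eq_zero, zero_add,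
    add_comm]
  · congr 1
    refine tsum_congr fun k => ?_
    rw [coord_sub, coord_trunc, if_neg (by omega), zero_sub, abs_neg]
  · intro k hk
    rw [coord_sub, coord_trunc, if_pos (Finset.mem_range.mp hk), sub_self, abs_zero]

lemma dense_span_e : closure (Submodule.span ℝ (Set.range (e p)) : Set (RenormedL1 p)) =
    Set.univ := by
  refine Set.eq_univ_of_forall fun x => mem_closure_of_tendsto (tendsto_trunc x) ?_
  refine Eventually.of_forall fun n => ?_
  change ∑ k ∈ Finset.range n, coord x k • e p k ∈ Submodule.span ℝ (Set.range (e p))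
  refine Submodule.sum_mem _ fun k _ => ?_
  exact Submodule.smul_mem _ _ (Submodule.subset_span ⟨k, rfl⟩)

/-- Along the ray through its truncation, the norm grows at `x` almost like the norm of the
truncation. -/
lemma norm_smul_trunc_add_tail_le (x : RenormedL1 p) (n : ℕ) {a : ℝ} (ha : 0 ≤ a) :
    ‖a • trunc n x + (x - trunc n x)‖ ≤
      ‖x‖ + (a - 1) * ‖trunc n x‖ + |a - 1| * ‖x - trunc n x‖ := by
  rcases le_total 1 a with h | h
  · have h1 : a • trunc n x + (x - trunc n x) = x + (a - 1) • trunc n x := by module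
    have h2 := norm_add_le x ((a - 1) • trunc n x)
    rw [norm_smul, Real.norm_of_nonneg (by linarith)] at h2
    rw [h1]
    have : 0 ≤ |a - 1| * ‖x - trunc n x‖ := by positivity
    linarith
  · have h1 : a • trunc n x + (x - trunc n x) = a • x + (1 - a) • (x - trunc n x) := by module
    have h2 := norm_add_le (a • x) ((1 - a) • (x - trunc n x))
    rw [norm_smul, norm_smul, Real.norm_of_nonneg ha, Real.norm_of_nonneg (by linarith)] at h2
    rw [h1, abs_of_nonpos (by linarith)]
    have h3 := mul_le_mul_of_nonneg_left (norm_trunc_le n x) (by linarith : 0 ≤ 1 - a)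
    linarith

lemma norm_add_smul_e_le (x : RenormedL1 p) {n k : ℕ} (hk : k < n)
    (hx : 0 < vartheta p (coord x) n) (s : ℝ) :
    ‖x + s • e p k‖ ≤ ‖x‖ + (vartheta p (coord (x + s • e p k)) n - vartheta p (coord x) n) +
      |s| * ‖e p k‖ / vartheta p (coord x) n * ‖x - trunc n x‖ := by
  set A := vartheta p (coord x) n with hA
  set B := vartheta p (coord (x + s • e p k)) n with hB
  have hB0 : 0 ≤ B := vartheta_nonneg _ _ _
  have hBA : |B - A| ≤ |s| * ‖e p k‖ := by
    rw [hA, hB, ← norm_trunc, ← norm_trunc]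
    refine (abs_norm_sub_norm_le _ _).trans ?_
    rw [← map_sub, add_sub_cancel_left]
    refine (norm_trunc_le _ _).trans ?_
    rw [norm_smul, Real.norm_eq_abs]
  have heq : ‖x + s • e p k‖ = ‖(B / A) • trunc n x + (x - trunc n x)‖ := by
    refine norm_congr_of_le (n := n) ?_ ?_
    · have h1 : vartheta p (coord ((B / A) • trunc n x + (x - trunc n x))) n =
          vartheta p (fun j => B / A * coord x j) n := by
        refine vartheta_congr p fun j hj => ?_
        rw [coord_add, coord_sub, coord_smul, coord_trunc, if_pos hj, sub_self, add_zero]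
      rw [h1, vartheta_smul, abs_of_nonneg (by positivity), ← hA, div_mul_cancel₀ _ hx.ne']
    · intro j hj
      rw [coord_add, coord_add, coord_sub, coord_smul, coord_smul, coord_trunc,
        if_neg (by omega), coord_e, if_neg (by omega)]
      simp
  rw [heq]
  refine (norm_smul_trunc_add_tail_le x n (by positivity)).trans ?_
  have h2 : (B / A - 1) * ‖trunc n x‖ = B - A := by
    rw [norm_trunc, ← hA]
    field_simp
  have h3 : |B / A - 1| ≤ |s| * ‖e p k‖ / A := by
    rw [div_sub_one hx.ne', abs_div, abs_of_pos hx]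
    gcongr
  rw [h2]
  gcongr

/-- Two norming functionals of the same element agree up to the size of its tails. -/
lemma sub_apply_e_le (x : RenormedL1 p) {F H : RenormedL1 p →L[ℝ] ℝ}
    (hF : IsNormingFunctional F x) (hH : IsNormingFunctional H x) {n k : ℕ} (hk : k < n)
    (hx : 0 < vartheta p (coord x) n) :
    F (e p k) - H (e p k) ≤
      2 * (‖e p k‖ / vartheta p (coord x) n * ‖x - trunc n x‖) := by
  set A := vartheta p (coord x) n with hA
  set r := ‖e p k‖ / A * ‖x - trunc n x‖ with hr
  obtain ⟨d, hd⟩ := exists_hasDerivAt_vartheta p (coord x) (coord (e p k)) n hx.ne'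
  set θ : ℝ → ℝ := fun s => vartheta p (fun j => coord x j + s * coord (e p k) j) n with hθ
  have hθ0 : θ 0 = A := by simp [hθ, hA]
  have hd' : HasDerivAt (fun s => θ (-s)) (-d) 0 := by
    have h : HasDerivAt θ d (-0) := by simpa using hd
    simpa [Function.comp_def] using h.comp (0 : ℝ) (hasDerivAt_neg 0)
  have hsum : HasDerivAt (fun s => θ s + θ (-s)) 0 0 := by
    have h := hd.add hd'
    rwa [add_neg_cancel] at h
  have hbound : ∀ L : RenormedL1 p →L[ℝ] ℝ, IsNormingFunctional L x → ∀ s : ℝ,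
      s * L (e p k) ≤ θ s - A + |s| * r := by
    intro L hL s
    have h1 : L (x + s • e p k) ≤ ‖x + s • e p k‖ := by
      refine (le_abs_self _).trans ?_
      have := L.le_opNorm (x + s • e p k)
      rwa [hL.1, one_mul] at this
    have h2 := norm_add_smul_e_le x hk hx s
    rw [map_add, hL.2, map_smul, smul_eq_mul] at h1
    have h3 : |s| * ‖e p k‖ / A * ‖x - trunc n x‖ = |s| * r := by rw [hr]; ring
    have h4 : vartheta p (coord (x + s • e p k)) n = θ s := rfl
    rw [← hA, h3, h4] at h2
    linarith
  have hev : ∀ᶠ s in 𝓝[>] (0 : ℝ),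
      F (e p k) - H (e p k) ≤ s⁻¹ • ((θ (0 + s) + θ (-(0 + s))) - (θ 0 + θ (-0))) + 2 * r := by
    filter_upwards [self_mem_nhdsWithin] with s hs
    have hs : 0 < s := hs
    have h1 := hbound F hF s
    have h2 := hbound H hH (-s)
    rw [abs_neg] at h2
    rw [abs_of_pos hs] at h1 h2
    rw [neg_zero, hθ0, zero_add, smul_eq_mul, ← sub_le_iff_le_add, ← div_eq_inv_mul,
      le_div_iff₀ hs]
    linarith
  have hlim := (hsum.tendsto_slope_zero_right).add_const (2 * r)
  rw [zero_add] at hlim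
  exact ge_of_tendsto hlim hev

lemma apply_e_le_of_isNormingFunctional {x : RenormedL1 p} (hx : x ≠ 0)
    {F H : RenormedL1 p →L[ℝ] ℝ}
    (hF : IsNormingFunctional F x) (hH : IsNormingFunctional H x) (k : ℕ) :
    F (e p k) ≤ H (e p k) := by
  have hpos : 0 < ‖x‖ := norm_pos_iff.mpr hx
  have h1 : Tendsto (fun n => ‖x - trunc n x‖) atTop (𝓝 0) := by
    simpa using ((tendsto_trunc x).const_sub x).norm
  have hlim : Tendsto (fun n => 2 * (‖e p k‖ / vartheta p (coord x) n * ‖x - trunc n x‖)) atTop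
      (𝓝 0) := by
    simpa using (((tendsto_const_nhds (x := ‖e p k‖)).div (tendsto_vartheta x) hpos.ne').mul h1).const_mul 2
  rw [← sub_nonpos]
  refine ge_of_tendsto hlim ?_
  filter_upwards [eventually_gt_atTop k, (tendsto_vartheta x).eventually_const_lt hpos]
    with n hn hn'
  exact sub_apply_e_le x hF hH hn hn'

lemma isSmoothSpace : IsSmoothSpace (RenormedL1 p) := by
  intro x hx
  obtain ⟨F, hF1, hF2⟩ := exists_dual_vector ℝ x (norm_ne_zero_iff.mpr hx)
  have hF : IsNormingFunctional F x := ⟨hF1, hF2⟩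
  refine ⟨F, hF, fun H hH => ?_⟩
  refine ContinuousLinearMap.ext_on (s := Set.range (e p))
    (dense_iff_closure_eq.mpr dense_span_e) ?_
  rintro _ ⟨k, rfl⟩
  exact le_antisymm (apply_e_le_of_isNormingFunctional hx hH hF k)
    (apply_e_le_of_isNormingFunctional hx hF hH k)

lemma norm_e_add_smul_e (n : ℕ) (u : ℝ) :
    ‖e p n + u • e p (n + 1)‖ = (1 + |u| ^ p (n + 1)) ^ (1 / p (n + 1)) := by
  have hc : ∀ k, coord (e p n + u • e p (n + 1)) k =
      (if k = n then 1 else 0) + u * (if k = n + 1 then 1 else 0) := fun k => by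
    rw [coord_add, coord_smul, coord_e, coord_e]
  have h0 : vartheta p (coord (e p n + u • e p (n + 1))) n = 0 :=
    vartheta_eq_zero p fun k hk => by
      rw [hc, if_neg (by omega), if_neg (by omega)]; ring
  rw [norm_eq_vartheta (n := n + 2) fun k hk => by
      rw [hc, if_neg (by omega), if_neg (by omega)]; ring,
    vartheta_succ, vartheta_succ_of_vartheta_eq_zero p h0, hc, hc]
  simp

lemma norm_e (n : ℕ) : ‖e p n‖ = 1 := by
  have h := norm_e_add_smul_e (p := p) n 0
  simpa [Real.zero_rpow (p.pos (n + 1)).ne'] using h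

lemma le_modulusOfSmoothness {u : ℝ} (hu : 0 < u) :
    u ≤ modulusOfSmoothness (RenormedL1 p) u := by
  have hbdd : BddAbove (Set.range fun z : Metric.sphere (0 : RenormedL1 p) 1 ×
      Metric.sphere (0 : RenormedL1 p) 1 =>
      (‖(z.1 : RenormedL1 p) + u • (z.2 : RenormedL1 p)‖ +
        ‖(z.1 : RenormedL1 p) - u • (z.2 : RenormedL1 p)‖) / 2 - 1) := by
    refine ⟨u, ?_⟩
    rintro _ ⟨⟨⟨x, hx⟩, ⟨y, hy⟩⟩, rfl⟩
    rw [mem_sphere_zero_iff_norm] at hx hy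
    have h1 := norm_add_le x (u • y)
    have h2 := norm_sub_le x (u • y)
    rw [norm_smul, Real.norm_of_nonneg hu.le, hx, hy] at h1 h2
    simp only
    linarith
  have hle : ∀ n, (1 + u ^ p (n + 1)) ^ (1 / p (n + 1)) - 1 ≤
      modulusOfSmoothness (RenormedL1 p) u := by
    intro n
    have h := le_ciSup hbdd (⟨e p n, by simp [norm_e]⟩, ⟨e p (n + 1), by simp [norm_e]⟩)
    refine le_trans (le_of_eq ?_) h
    have h2 := norm_e_add_smul_e (p := p) n u
    have h3 := norm_e_add_smul_e (p := p) n (-u)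
    rw [neg_smul, ← sub_eq_add_neg, abs_neg] at h3
    rw [abs_of_pos hu] at h2 h3
    simp only [h2, h3]
    ring
  have hinv : Tendsto (fun n => 1 / p (n + 1)) atTop (𝓝 1) :=
    p.tendsto_inv.comp (tendsto_add_atTop_nat 1)
  have hp : Tendsto (fun n => p (n + 1)) atTop (𝓝 1) := by
    simpa using hinv.inv₀ one_ne_zero
  have hlim : Tendsto (fun n => (1 + u ^ p (n + 1)) ^ (1 / p (n + 1)) - 1) atTop
      (𝓝 ((1 + u ^ (1 : ℝ)) ^ (1 : ℝ) - 1)) := by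
    refine Tendsto.sub_const (Tendsto.rpow ?_ hinv (Or.inl (by positivity))) 1
    exact (Tendsto.rpow tendsto_const_nhds hp (Or.inl hu.ne')).const_add 1
  rw [Real.rpow_one, Real.rpow_one, add_sub_cancel_left] at hlim
  exact le_of_tendsto' hlim hle

lemma not_isUniformlySmoothSpace : ¬ IsUniformlySmoothSpace (RenormedL1 p) := by
  intro h
  have h1 := h.def (c := 1 / 2) (by norm_num)
  have h2 : ∀ᶠ u in 𝓝[>] (0 : ℝ), False := by
    filter_upwards [h1.filter_mono nhdsWithin_le_nhds, self_mem_nhdsWithin] with u hu hu0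
    have hu0 : 0 < u := hu0
    have h3 := le_modulusOfSmoothness (p := p) hu0
    rw [Real.norm_of_nonneg hu0.le] at hu
    have := (le_abs_self _).trans hu
    linarith
  exact h2.exists.elim fun _ => id

lemma coord_g_succ (n k : ℕ) :
    coord (g p (n + 1)) k = (if k = n then 1 else 0) + if k = n + 1 then 1 else 0 := by
  rw [g, coord_add, coord_e, coord_e]

lemma norm_g_succ (n : ℕ) : ‖g p (n + 1)‖ = (2 : ℝ) ^ (1 / p (n + 1)) := by
  have h := norm_e_add_smul_e (p := p) n 1
  rw [one_smul, abs_one, Real.one_rpow, one_add_one_eq_two] at h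
  exact h

lemma norm_g_zero : ‖g p 0‖ = ((2 : ℝ) ^ (p 2 / p 1) + 1) ^ (1 / p 2) := by
  have hc : ∀ k, coord (g p 0) k =
      (if k = 0 then 1 else 0) + (if k = 1 then 1 else 0) + if k = 2 then 1 else 0 := fun k => by
    rw [g, coord_add, coord_add, coord_e, coord_e, coord_e]
  have h1 : vartheta p (coord (g p 0)) 1 = 1 := by
    rw [vartheta_succ_of_vartheta_eq_zero p rfl, hc]
    simp
  have h2 : vartheta p (coord (g p 0)) 2 = 2 ^ (1 / p 1) := by
    rw [vartheta_succ, h1, hc]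
    norm_num
  rw [norm_eq_vartheta (n := 3) fun k hk => by
    rw [hc, if_neg (by omega), if_neg (by omega), if_neg (by omega)]; ring,
    vartheta_succ, h2, hc, ← Real.rpow_mul zero_le_two]
  norm_num
  congr 3
  ring

lemma norm_g_pos (n : ℕ) : 0 < ‖g p n‖ := by
  cases n with
  | zero => rw [norm_g_zero]; positivity
  | succ n => rw [norm_g_succ]; positivity

lemma e_zero_eq : e p 0 = g p 0 - g p 2 := by
  simp only [g]
  abel

lemma g_mem_span_dict (n : ℕ) : g p n ∈ Submodule.span ℝ (dict p) := by
  have h : ‖g p n‖ • (‖g p n‖⁻¹ • g p n) = g p n := smul_inv_smul₀ (norm_g_pos n).ne' _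
  rw [← h]
  exact Submodule.smul_mem _ _ (Submodule.subset_span ⟨n, Or.inl rfl⟩)

lemma e_mem_span_dict (n : ℕ) : e p n ∈ Submodule.span ℝ (dict p) := by
  induction n with
  | zero =>
    rw [e_zero_eq]
    exact Submodule.sub_mem _ (g_mem_span_dict 0) (g_mem_span_dict 2)
  | succ n ih =>
    have h : e p (n + 1) = g p (n + 1) - e p n := by simp only [g]; abel
    rw [h]
    exact Submodule.sub_mem _ (g_mem_span_dict _) ih

lemma isDictionary_dict : IsDictionary (dict p) where
  norm_eq_one := by
    have h : ∀ n, ‖‖g p n‖⁻¹ • g p n‖ = 1 := fun n => by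
      rw [norm_smul, norm_inv, norm_norm, inv_mul_cancel₀ (norm_g_pos n).ne']
    rintro _ ⟨n, rfl | rfl⟩
    · exact h n
    · rw [norm_neg]
      exact h n
  neg_mem := by
    rintro _ ⟨n, rfl | rfl⟩
    · exact ⟨n, Or.inr rfl⟩
    · exact ⟨n, Or.inl (neg_neg _)⟩
  dense_span := by
    refine Set.univ_subset_iff.mp (dense_span_e.symm.subset.trans (closure_mono ?_))
    refine Submodule.span_le.mpr ?_
    rintro _ ⟨n, rfl⟩
    exact e_mem_span_dict n

variable (p)

/-- The elements selected by the divergent realization of the greedy algorithm. -/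
def greedyElement (n : ℕ) : RenormedL1 p := (-1 : ℝ) ^ n • ‖g p (n + 1)‖⁻¹ • g p (n + 1)

/-- The span of the first `n` selected elements. -/
def greedySpan (n : ℕ) : Submodule ℝ (RenormedL1 p) :=
  Submodule.span ℝ (greedyElement p '' Set.Iio n)

variable {p}

instance (n : ℕ) : FiniteDimensional ℝ (greedySpan p n) :=
  FiniteDimensional.span_of_finite ℝ ((Set.finite_Iio n).image _)

lemma greedyElement_mem_dict (n : ℕ) : greedyElement p n ∈ dict p := by
  refine ⟨n + 1, ?_⟩
  rcases neg_one_pow_eq_or ℝ n with h | h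
  · exact Or.inl (by rw [greedyElement, h, one_smul])
  · exact Or.inr (by rw [greedyElement, h, neg_one_smul])

lemma g_succ_mem_greedySpan {n k : ℕ} (hk : k < n) : g p (k + 1) ∈ greedySpan p n := by
  have h : g p (k + 1) = ((-1 : ℝ) ^ k * ‖g p (k + 1)‖) • greedyElement p k := by
    have h1 : (-1 : ℝ) ^ k * ‖g p (k + 1)‖ * ((-1) ^ k * ‖g p (k + 1)‖⁻¹) = 1 := by
      rw [mul_mul_mul_comm, ← mul_pow, mul_inv_cancel₀ (norm_g_pos _).ne']
      norm_num
    rw [greedyElement, smul_smul, smul_smul, mul_assoc (_ * _), h1, one_smul]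
  rw [h]
  exact Submodule.smul_mem _ _ (Submodule.subset_span ⟨k, hk, rfl⟩)

lemma greedySpan_le {n : ℕ} {W : Submodule ℝ (RenormedL1 p)} (h : ∀ k < n, g p (k + 1) ∈ W) :
    greedySpan p n ≤ W := by
  refine Submodule.span_le.mpr ?_
  rintro _ ⟨k, hk, rfl⟩
  exact W.smul_mem _ (W.smul_mem _ (h k hk))

lemma coord_eq_zero_of_mem_greedySpan {n : ℕ} {x : RenormedL1 p} (hx : x ∈ greedySpan p n) {j : ℕ}
    (hj : n < j) : coord x j = 0 := by
  have h : greedySpan p n ≤ LinearMap.ker (coordₗ j) := greedySpan_le fun k hk => by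
    change coord (g p (k + 1)) j = 0
    rw [coord_g_succ, if_neg (by omega), if_neg (by omega), add_zero]
  exact h hx

/-- The spans of the selected elements stay away from `e_1`. -/
lemma one_le_norm_toL1_sub {n : ℕ} {x : RenormedL1 p} (hx : x ∈ greedySpan p n) :
    1 ≤ ‖toL1 (e p 0 - x)‖ := by
  let A : RenormedL1 p →ₗ[ℝ] ℝ := ∑ j ∈ Finset.range (n + 1), (-1 : ℝ) ^ j • coordₗ j
  have hA : ∀ y, A y = ∑ j ∈ Finset.range (n + 1), (-1) ^ j * coord y j := fun y => by
    simp only [A, LinearMap.sum_apply]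
    rfl
  have h0 : A x = 0 := by
    have h : greedySpan p n ≤ LinearMap.ker A := greedySpan_le fun k hk => by
      rw [LinearMap.mem_ker, hA]
      simp only [coord_g_succ, mul_add, mul_ite, mul_one, mul_zero, Finset.sum_add_distrib,
        Finset.sum_ite_eq', Finset.mem_range]
      rw [if_pos (by omega), if_pos (by omega), pow_succ]
      ring
    exact h hx
  have h1 : A (e p 0) = 1 := by
    rw [hA]
    simp [coord_e]
  have h2 : A (e p 0 - x) = 1 := by rw [map_sub, h0, h1, sub_zero]
  rw [← h2, hA, norm_toL1]
  refine (Finset.sum_le_sum fun j _ => ?_).trans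
    ((summable_coord (e p 0 - x)).sum_le_tsum (Finset.range (n + 1)) fun _ _ => abs_nonneg _)
  refine (le_abs_self _).trans_eq ?_
  rw [abs_mul, abs_pow, abs_neg, abs_one, one_pow, one_mul]

lemma norm_g_succ_le_norm_g_zero (h : (2 : ℝ) ^ p 2 ≤ 1 + (2 : ℝ) ^ (p 2 / p 1)) (n : ℕ) :
    ‖g p (n + 1)‖ ≤ ‖g p 0‖ := by
  have hp := p.pos 2
  calc ‖g p (n + 1)‖ = (2 : ℝ) ^ (1 / p (n + 1)) := norm_g_succ n
    _ ≤ (2 : ℝ) ^ (1 : ℝ) := by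
      refine Real.rpow_le_rpow_of_exponent_le one_le_two ?_
      linarith [p.one_sub_inv_nonneg (n + 1)]
    _ = ((2 : ℝ) ^ p 2) ^ (1 / p 2) := by
      rw [Real.rpow_one, one_div, Real.rpow_rpow_inv zero_le_two hp.ne']
    _ ≤ ‖g p 0‖ := by
      rw [norm_g_zero, add_comm ((2 : ℝ) ^ (p 2 / p 1))]
      exact Real.rpow_le_rpow (by positivity) h (by positivity)

/-- A functional that vanishes on `g_1, …, g_n` alternates on the first `n + 1` basis vectors. -/
lemma apply_e_of_vanishing {F : RenormedL1 p →L[ℝ] ℝ} {n : ℕ}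
    (hg : ∀ k < n, F (g p (k + 1)) = 0) {k : ℕ} (hk : k ≤ n) :
    F (e p k) = (-1) ^ k * F (e p 0) := by
  induction k with
  | zero => simp
  | succ k ih =>
    have h := hg k hk
    rw [g, map_add, ih (by omega)] at h
    rw [pow_succ]
    linarith

lemma apply_dict_le (h : (2 : ℝ) ^ p 2 ≤ 1 + (2 : ℝ) ^ (p 2 / p 1))
    {F : RenormedL1 p →L[ℝ] ℝ} {n : ℕ} (hF : 0 ≤ F (e p 0))
    (hg : ∀ k < n, F (g p (k + 1)) = 0) (he : ∀ k, n < k → F (e p k) = 0)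
    {v : RenormedL1 p} (hv : v ∈ dict p) : F v ≤ F (greedyElement p n) := by
  set c := F (e p 0) with hc
  have hval : F (greedyElement p n) = ‖g p (n + 1)‖⁻¹ * c := by
    have h1 : F (g p (n + 1)) = (-1) ^ n * c := by
      rw [g, map_add, he (n + 1) (by omega), add_zero, apply_e_of_vanishing hg le_rfl]
    rw [greedyElement, map_smul, map_smul, smul_eq_mul, smul_eq_mul, h1]
    have h2 : (-1 : ℝ) ^ n * (-1) ^ n = 1 := by rw [← mul_pow]; norm_num
    linear_combination ‖g p (n + 1)‖⁻¹ * c * h2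
  have hpos := norm_g_pos (p := p) (n + 1)
  have hkey : ∀ m, |F (‖g p m‖⁻¹ • g p m)| ≤ ‖g p (n + 1)‖⁻¹ * c := by
    intro m
    rw [map_smul, smul_eq_mul, abs_mul, abs_of_nonneg (by positivity)]
    have hnn : 0 ≤ ‖g p (n + 1)‖⁻¹ * c := by positivity
    cases m with
    | zero =>
      have hle : |F (g p 0)| ≤ c := by
        rw [g, map_add, map_add]
        rcases n with _ | _ | n
        · rw [he 1 (by omega), he 2 (by omega), add_zero, add_zero, abs_of_nonneg hF]
        · rw [apply_e_of_vanishing hg (k := 1) le_rfl, he 2 (by omega), ← hc]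
          simpa using hF
        · rw [apply_e_of_vanishing hg (k := 1) (by omega),
            apply_e_of_vanishing hg (k := 2) (by omega), ← hc]
          simp [abs_of_nonneg hF]
      have := norm_g_succ_le_norm_g_zero h n
      gcongr
    | succ m =>
      rcases lt_trichotomy m n with hm | rfl | hm
      · rw [hg m hm, abs_zero, mul_zero]
        exact hnn
      · rw [g, map_add, he (m + 1) (by omega), add_zero, apply_e_of_vanishing hg le_rfl, ← hc,
          abs_mul, abs_pow, abs_neg, abs_one, one_pow, one_mul, abs_of_nonneg hF]
      · rw [show g p (m + 1) = e p m + e p (m + 1) from rfl, map_add, he m hm,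
          he (m + 1) (by omega), add_zero, abs_zero, mul_zero]
        exact hnn
  rw [hval]
  rcases hv with ⟨m, rfl | rfl⟩
  · exact (le_abs_self _).trans (hkey m)
  · rw [map_neg]
    exact (neg_le_abs _).trans (hkey m)

/-- The approximation and the functional of one step of the divergent realization. -/
lemma exists_greedy_step (n : ℕ) :
    ∃ G ∈ greedySpan p n, (∀ H ∈ greedySpan p n, ‖e p 0 - G‖ ≤ ‖e p 0 - H‖) ∧
      ∃ F : RenormedL1 p →L[ℝ] ℝ, ‖F‖ ≤ 1 ∧ F (e p 0 - G) = ‖e p 0 - G‖ ∧ 0 ≤ F (e p 0) ∧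
        (∀ k < n, F (g p (k + 1)) = 0) ∧ ∀ k, n < k → F (e p k) = 0 := by
  obtain ⟨G, hG, hbest, F, hF1, hF0, hFf⟩ := exists_best_approx_and_functional
    (greedySpan p n) (e p 0)
  have hfix : ∀ x ∈ greedySpan p n, trunc (n + 1) x = x := fun x hx =>
    trunc_eq_self fun k hk => coord_eq_zero_of_mem_greedySpan hx (by omega)
  have he0 : trunc (n + 1) (e p 0) = e p 0 :=
    trunc_eq_self fun k hk => by rw [coord_e, if_neg (by omega)]
  refine ⟨G, hG, hbest, F.comp (truncL (n + 1)), ?_, ?_, ?_, ?_, ?_⟩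
  · calc ‖F.comp (truncL (n + 1))‖ ≤ ‖F‖ * ‖truncL (p := p) (n + 1)‖ :=
          ContinuousLinearMap.opNorm_comp_le _ _
      _ ≤ 1 * 1 := by
        gcongr
        exact norm_truncL_le _
      _ = 1 := one_mul 1
  · rw [ContinuousLinearMap.comp_apply, truncL_apply, map_sub, he0, hfix G hG, map_sub, hF0 G hG,
      sub_zero, hFf]
  · rw [ContinuousLinearMap.comp_apply, truncL_apply, he0, hFf]
    exact norm_nonneg _
  · intro k hk
    have hmem := g_succ_mem_greedySpan (p := p) hk
    rw [ContinuousLinearMap.comp_apply, truncL_apply, hfix _ hmem, hF0 _ hmem]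
  · intro k hk
    have h0 : trunc (n + 1) (e p k) = 0 := by
      ext j
      rw [coord_trunc, coord_e, coord_zero]
      split_ifs <;> first | rfl | omega
    rw [ContinuousLinearMap.comp_apply, truncL_apply, h0, map_zero]

lemma wcgaDiverges (h : (2 : ℝ) ^ p 2 ≤ 1 + (2 : ℝ) ^ (p 2 / p 1)) {t : ℕ → ℝ}
    (ht : IsWeaknessSequence t) : WCGADiverges (dict p) t (e p 0) := by
  choose G hG hbest F hF1 hFG hF0 hFg hFe using exists_greedy_step (p := p)
  have hIic : ∀ n, Submodule.span ℝ (greedyElement p '' Set.Iic n) = greedySpan p (n + 1) := by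
    intro n
    rw [greedySpan]
    congr 2
    ext k
    simp only [Set.mem_Iic, Set.mem_Iio]
    omega
  refine ⟨F, greedyElement p, G, ⟨?_, hF1, fun n => (hFG n).ge, greedyElement_mem_dict, ?_, ?_, ?_⟩,
    ?_⟩
  · simpa [greedySpan] using hG 0
  · intro n
    have hne : Nonempty (dict p) := ⟨⟨_, greedyElement_mem_dict n⟩⟩
    have hsup : (⨆ v : dict p, F n (v : RenormedL1 p)) ≤ F n (greedyElement p n) :=
      ciSup_le fun v => apply_dict_le h (hF0 n) (hFg n) (hFe n) v.2
    have hnn : 0 ≤ F n (greedyElement p n) := by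
      have h1 := apply_dict_le h (hF0 n) (hFg n) (hFe n) (greedyElement_mem_dict n)
      have h2 := apply_dict_le h (hF0 n) (hFg n) (hFe n)
        (isDictionary_dict.neg_mem _ (greedyElement_mem_dict n))
      rw [map_neg] at h2
      linarith
    exact (mul_le_mul_of_nonneg_left hsup (ht n).1).trans (mul_le_of_le_one_left hnn (ht n).2)
  · intro n
    rw [hIic]
    exact hG (n + 1)
  · intro n
    rw [hIic]
    exact le_ciInf fun H => hbest (n + 1) H H.2
  · intro hlim
    have h1 : Tendsto (fun n => (2 : ℝ) ^ (∑' k, (1 - 1 / p k)) * ‖e p 0 - G n‖) atTop (𝓝 0) := by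
      simpa using ((hlim.const_sub (e p 0)).norm).const_mul ((2 : ℝ) ^ (∑' k, (1 - 1 / p k)))
    have h2 : (1 : ℝ) ≤ 0 := ge_of_tendsto' h1 fun n =>
      (one_le_norm_toL1_sub (hG n)).trans (norm_toL1_le _)
    linarith

end RenormedL1

/-- The exponents `1 + 2^{-n}`, `n ≥ 1`. -/
def geometricExponents : ExponentSeq where
  exponent n := 1 + (1 / 2) ^ (n + 1)
  antitone' m n hmn := by
    have : (1 / 2 : ℝ) ^ (n + 1) ≤ (1 / 2) ^ (m + 1) :=
      pow_le_pow_of_le_one (by norm_num) (by norm_num) (by omega)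
    simpa using this
  one_lt' n := lt_add_of_pos_right _ (by positivity)
  summable' := by
    have hs : Summable fun n : ℕ => (1 / 2 : ℝ) ^ (n + 1) :=
      (summable_nat_add_iff 1).mpr summable_geometric_two
    refine Summable.of_nonneg_of_le (fun n => ?_) (fun n => ?_) hs
    · have h : (0 : ℝ) < (1 / 2) ^ (n + 1) := by positivity
      rw [sub_nonneg, div_le_one (by positivity)]
      linarith
    · have h : (0 : ℝ) < (1 / 2) ^ (n + 1) := by positivity
      rw [sub_le_iff_le_add, ← sub_le_iff_le_add', le_div_iff₀ (by positivity)]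
      nlinarith

lemma two_rpow_geometricExponents_le :
    (2 : ℝ) ^ geometricExponents 2 ≤
      1 + (2 : ℝ) ^ (geometricExponents 2 / geometricExponents 1) := by
  have h1 : geometricExponents 1 = 5 / 4 := by norm_num [geometricExponents]
  have h2 : geometricExponents 2 = 9 / 8 := by norm_num [geometricExponents]
  have h3 : (2 : ℝ) ^ (9 / 8 : ℝ) ≤ 9 / 4 := by
    have h := rpow_one_add_le_one_add_mul_self (s := 1) (p := 1 / 8) (by norm_num) (by norm_num)
      (by norm_num)
    rw [show (9 / 8 : ℝ) = 1 + 1 / 8 by norm_num, Real.rpow_add two_pos, Real.rpow_one]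
    norm_num at h ⊢
    linarith
  have h4 : (5 / 4 : ℝ) ≤ 2 ^ (9 / 8 / (5 / 4) : ℝ) := by
    have h : √(2 : ℝ) ≤ 2 ^ (9 / 8 / (5 / 4) : ℝ) := by
      rw [Real.sqrt_eq_rpow]
      exact Real.rpow_le_rpow_of_exponent_le one_le_two (by norm_num)
    exact (Real.le_sqrt' (by norm_num)).mpr (by norm_num) |>.trans h
  rw [h1, h2]
  linarith

end

theorem mainTheorem3 :
    (∀ p : ExponentSeq,
      -- `‖·‖_X` is equivalent to the norm of `ℓ₁`, and `X` is a Banach space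
      (∀ x : RenormedL1 p,
        (2 : ℝ) ^ (-∑' n, (1 - 1 / p n)) * ‖RenormedL1.toL1 x‖ ≤ ‖x‖ ∧
          ‖x‖ ≤ ‖RenormedL1.toL1 x‖) ∧
      CompleteSpace (RenormedL1 p) ∧
      -- `X` is smooth but not uniformly smooth
      IsSmoothSpace (RenormedL1 p) ∧
      ¬ IsUniformlySmoothSpace (RenormedL1 p) ∧
      -- the dictionary, and the element `f = e_1 = g_0 - g_2` of its linear span
      IsDictionary (RenormedL1.dict p) ∧
      RenormedL1.e p 0 = RenormedL1.g p 0 - RenormedL1.g p 2 ∧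
      RenormedL1.e p 0 ∈ Submodule.span ℝ (RenormedL1.dict p) ∧
      -- divergence of the WCGA for every weakness sequence, if the exponents
      -- `p_2 = p 1` and `p_3 = p 2` are small enough
      ((2 : ℝ) ^ p 2 ≤ 1 + (2 : ℝ) ^ (p 2 / p 1) →
        ∀ t : ℕ → ℝ, IsWeaknessSequence t →
          WCGADiverges (RenormedL1.dict p) t (RenormedL1.e p 0))) ∧
    -- such sequences of exponents exist
    ∃ p : ExponentSeq, (2 : ℝ) ^ p 2 ≤ 1 + (2 : ℝ) ^ (p 2 / p 1) := by
  refine ⟨fun p => ⟨fun x => ⟨RenormedL1.two_rpow_mul_norm_toL1_le x,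
    RenormedL1.norm_le_norm_toL1 x⟩, inferInstance, RenormedL1.isSmoothSpace,
    RenormedL1.not_isUniformlySmoothSpace, RenormedL1.isDictionary_dict, RenormedL1.e_zero_eq,
    RenormedL1.e_mem_span_dict 0, fun h _ ht => RenormedL1.wcgaDiverges h ht⟩,
    geometricExponents, two_rpow_geometricExponents_le⟩
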